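/- Let $a<b$ be integers with $a\ge 2$, let $p,\tilde p>0$ be real numbers, and let $q,\tilde q$ be even integers with $2\le q\le b$ and $2\le\tilde q\le a$. Put $$f(x,y)=x^ay^b+x^ay^{b-q}e^{-1/|x|^p}+x^{a-\tilde q}y^be^{-1/|y|^{\tilde p}}\qquad((x,y)\in\mathbb R^2),$$ where $e^{-1/|t|^p}$ and $e^{-1/|t|^{\tilde p}}$ are understood to be $0$ at $t=0$. Let $U\subset\mathbb R^2$ be an open neighbourhood of the origin, and let $C_0^\infty(U)$ be the set of real-valued smooth functions with compact support contained in $U$. For $\varphi\in C_0^\infty(U)$ let $$Z_f(\varphi)(s)=\int_{\mathbb R^2}|f(x,y)|^s\varphi(x,y)\,dx\,dy\qquad(\mathrm{Re}(s)>0).$$ For an open set $W\subset\mathbb C$ containing $\{\mathrm{Re}(s)>0\}$, we say that $Z_f(\varphi)$ can be meromorphically continued to $W$ if there is a meromorphic function on $W$ that equals $Z_f(\varphi)$ on $\{\mathrm{Re}(s)>0\}$. In $[0,\infty]$ define $$m_0(f,\varphi)=\sup\{\rho>0: Z_f(\varphi)\text{ can be meromorphically continued to }\mathrm{Re}(s)>-\rho\},\qquad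 m_0(f)=\inf\{m_0(f,\varphi):\varphi\in C_0^\infty(U)\}.$$ Then the following hold. 1. If $\varphi\in C_0^\infty(U)$ satisfies $\varphi(0,0)>0$ and $\varphi\ge 0$ on $U$, then $Z_f(\varphi)$ cannot be meromorphically continued to any open neighbourhood of $s=-1/b$ in $\mathbb C$; that is, for no open set $N\ni -1/b$ can $Z_f(\varphi)$ be meromorphically continued to $\{\mathrm{Re}(s)>-1/b\}\cup N$. 2. $m_0(f)=1/b$. -/

import Mathlib

open MeasureTheory
open scoped ContDiff ENNReal

noncomputable section

namespace LocalZeta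

/-- The flat function `e^{-1/|t|^p}` on the real line, with value `0` at `t = 0`. -/
def flatExp (p t : ℝ) : ℝ :=
  if t = 0 then 0 else Real.exp (-1 / |t| ^ p)

/-- The function
`f(x,y) = x^a y^b + x^a y^(b-q) e^{-1/|x|^p} + x^(a-q') y^b e^{-1/|y|^p'}`. -/
def modelFun (a b q q' : ℕ) (p p' : ℝ) (z : ℝ × ℝ) : ℝ :=
  z.1 ^ a * z.2 ^ b + z.1 ^ a * z.2 ^ (b - q) * flatExp p z.1
    + z.1 ^ (a - q') * z.2 ^ b * flatExp p' z.2

/-- `φ` belongs to `C_0^∞(U)`: it is smooth, with compact support contained in `U`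
(and is extended by `0` to the whole plane). -/
structure IsTestFunction (U : Set (ℝ × ℝ)) (φ : ℝ × ℝ → ℝ) : Prop where
  smooth : ContDiff ℝ ∞ φ
  compact_support : HasCompactSupport φ
  support_subset : tsupport φ ⊆ U

/-- The integral `Z_f(φ)(s) = ∫ |f(x,y)|^s φ(x,y) dx dy`. -/
def zeta (f φ : ℝ × ℝ → ℝ) (s : ℂ) : ℂ :=
  ∫ z : ℝ × ℝ, ((|f z| : ℝ) : ℂ) ^ s * ((φ z : ℝ) : ℂ)

/-- The open half-plane `Re s > c`. -/
def halfPlane (c : ℝ) : Set ℂ := {s : ℂ | c < s.re}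

/-- `Z_f(φ)`, which is given by a convergent integral on `Re s > 0`, has a meromorphic
continuation to `W` (meant for open sets `W` containing the half-plane `Re s > 0`). -/
def MeromorphicallyContinuable (f φ : ℝ × ℝ → ℝ) (W : Set ℂ) : Prop :=
  ∃ F : ℂ → ℂ, MeromorphicOn F W ∧ ∀ s ∈ halfPlane 0, F s = zeta f φ s

/-- `m_0(f, φ)`: the supremum of all `ρ > 0` such that `Z_f(φ)` has a meromorphic continuation
to the half-plane `Re s > -ρ`. -/
def mZeroAt (f φ : ℝ × ℝ → ℝ) : ℝ≥0∞ :=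
  ⨆ (ρ : ℝ) (_ : 0 < ρ) (_ : MeromorphicallyContinuable f φ (halfPlane (-ρ))), ENNReal.ofReal ρ

/-- `m_0(f)`: the infimum of `m_0(f, φ)` over all `φ ∈ C_0^∞(U)`. -/
def mZero (U : Set (ℝ × ℝ)) (f : ℝ × ℝ → ℝ) : ℝ≥0∞ :=
  ⨅ (φ : ℝ × ℝ → ℝ) (_ : IsTestFunction U φ), mZeroAt f φ

end LocalZeta

end

/-! For nonnegative `g`, the zeta integral is the complex moment generating function of log|f| under
the measure with density `g`, so Landau's theorem applies at the abscissa of convergence σ = -1/b: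
if a continuation is meromorphic at σ without a pole there, the real integral still converges at
some t < σ. Three estimates contradict this.

Convergence for t > σ comes from |f| ≥ |x|^a |y|^b together with a < b. The absence of a pole comes
from the term that is flat in x: on |x| ≥ η it improves the bound to |f| ≥ c_η |y|^(b-q), whose
contribution stays bounded as t → σ, while the strip |x| ≤ η contributes at most O(η^(1-a/b)) / (t -
σ). Letting η → 0 gives (t - σ) Z(t) → 0. Divergence for t < σ comes from the thin region 0 < y <
r·e(x), e(x) = exp(-1/(q x^p)), where |f| ≤ 3 e(x)^b. Integrating |f|^t in y leaves e(x)^(bt+1),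
which blows up exponentially in x^(-p).

Hence σ is a singularity that is not a pole, and m_0(f) = 1/b. -/

/-! ### Landau's theorem for moment generating functions -/

section Landau

open ProbabilityTheory Filter Topology

variable {Ω : Type*} {m : MeasurableSpace Ω} {X : Ω → ℝ} {μ : Measure Ω} {σ₀ : ℝ}

/-- Landau's theorem for the moment generating function of a nonpositive random variable. -/
theorem exists_lt_mem_integrableExpSet_of_analyticAt_of_nonpos
    (hX : AEMeasurable X μ) (hX0 : ∀ᵐ x ∂μ, X x ≤ 0)
    (hint : Set.Ioi σ₀ ⊆ integrableExpSet X μ) {g : ℂ → ℂ} (hg : AnalyticAt ℂ g σ₀)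
    (heq : ∀ᶠ z in 𝓝 (σ₀ : ℂ), σ₀ < z.re → g z = complexMGF X μ z) :
    ∃ t < σ₀, t ∈ integrableExpSet X μ := by
  obtain ⟨R, hR, hball⟩ := Metric.eventually_nhds_iff_ball.1 (heq.and hg.eventually_analyticAt)
  -- The disc of radius 2d about s₁ = σ₀ + d stays inside the disc of radius R about σ₀, since 3d <
  -- R, and contains t = σ₀ - d/2, at distance 3d/2 from s₁.
  set d : ℝ := R / 4 with hd
  have hd0 : 0 < d := by positivity
  set s₁ : ℝ := σ₀ + d with hs₁
  set t : ℝ := σ₀ - d / 2 with ht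
  have hinter : (s₁ : ℂ).re ∈ interior (integrableExpSet X μ) :=
    interior_maximal hint isOpen_Ioi (by simp [hs₁, hd0])
  have hsub : ∀ z ∈ Metric.ball (s₁ : ℂ) (2 * d), z ∈ Metric.ball (σ₀ : ℂ) R := by
    intro z hz
    rw [Metric.mem_ball] at hz ⊢
    have h1 : dist (s₁ : ℂ) (σ₀ : ℂ) = d := by
      rw [dist_eq_norm, ← Complex.ofReal_sub, Complex.norm_real, hs₁]
      simp [abs_of_pos hd0]
    have := dist_triangle z (s₁ : ℂ) (σ₀ : ℂ)
    linarith
  have hdiff : DifferentiableOn ℂ g (Metric.ball (s₁ : ℂ) (2 * d)) := fun z hz ↦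
    ((hball z (hsub z hz)).2.differentiableAt).differentiableWithinAt
  have htmem : (t : ℂ) ∈ Metric.ball (s₁ : ℂ) (2 * d) := by
    rw [Metric.mem_ball, dist_eq_norm, ← Complex.ofReal_sub, Complex.norm_real, hs₁, ht,
      Real.norm_eq_abs, abs_lt]
    constructor <;> linarith
  have hsum := (Complex.hasSum_taylorSeries_on_ball hdiff htmem).summable
  have hev : g =ᶠ[𝓝 (s₁ : ℂ)] complexMGF X μ := by
    have h1 : ∀ᶠ z : ℂ in 𝓝 (s₁ : ℂ), σ₀ < z.re :=
      (isOpen_lt continuous_const Complex.continuous_re).eventually_mem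
        (by simp [hs₁, hd0])
    filter_upwards [h1, Metric.ball_mem_nhds (s₁ : ℂ) (by positivity : 0 < 2 * d)] with z hz hz'
    exact (hball z (hsub z hz')).1 hz
  -- These are the Taylor terms of g at s₁ evaluated at t. Since X ≤ 0 and t < s₁, the signs cancel
  -- and every integrand is nonnegative.
  set I : ℕ → ℝ := fun n ↦ ∫ x, (s₁ - t) ^ n / n.factorial * ((-X x) ^ n * Real.exp (s₁ * X x)) ∂μ
    with hI
  have hIeq : ∀ n : ℕ, ((n.factorial : ℂ)⁻¹ • ((t : ℂ) - s₁) ^ n • iteratedDeriv n g s₁)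
      = (I n : ℂ) := by
    intro n
    rw [hev.iteratedDeriv_eq n, iteratedDeriv_complexMGF hinter n, hI]
    simp only [smul_eq_mul]
    rw [← integral_complex_ofReal, ← integral_const_mul, ← integral_const_mul]
    congr 1
    ext x
    push_cast
    have : ((t : ℂ) - s₁) ^ n = (-1) ^ n * ((s₁ : ℂ) - t) ^ n := by
      rw [← mul_pow]; ring
    have h2 : (-(X x : ℂ)) ^ n = (-1) ^ n * (X x : ℂ) ^ n := by
      rw [← mul_pow]; ring
    rw [this, h2]
    ring
  have hsumI : Summable I := by
    rw [← Complex.summable_ofReal]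
    exact hsum.congr fun n ↦ hIeq n
  have hst : 0 < s₁ - t := by rw [hs₁, ht]; linarith
  have hnn : ∀ n : ℕ, ∀ᵐ x ∂μ,
      0 ≤ (s₁ - t) ^ n / n.factorial * ((-X x) ^ n * Real.exp (s₁ * X x)) := by
    intro n
    filter_upwards [hX0] with x hx
    have : 0 ≤ -X x := by linarith
    positivity
  have hIint : ∀ n : ℕ, Integrable
      (fun x ↦ (s₁ - t) ^ n / n.factorial * ((-X x) ^ n * Real.exp (s₁ * X x))) μ := by
    intro n
    refine Integrable.const_mul ?_ _
    refine ((integrable_pow_mul_exp_of_mem_interior_integrableExpSet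
      (by simpa using hinter) n).const_mul ((-1 : ℝ) ^ n)).congr (ae_of_all _ fun x ↦ ?_)
    simp only
    rw [← mul_assoc, ← mul_pow]
    ring
  refine ⟨t, by rw [ht]; linarith, ?_⟩
  have hmeas : ∀ n : ℕ, AEMeasurable (fun x ↦ ENNReal.ofReal
      ((s₁ - t) ^ n / n.factorial * ((-X x) ^ n * Real.exp (s₁ * X x)))) μ := by
    intro n
    fun_prop
  -- Tonelli exchanges sum and integral with no integrability known at t; the convergent Taylor
  -- series then bounds the result.
  have hL : ∫⁻ x, ENNReal.ofReal (Real.exp (t * X x)) ∂μ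
      = ∑' n, ENNReal.ofReal (I n) := by
    have h1 : ∫⁻ x, ENNReal.ofReal (Real.exp (t * X x)) ∂μ = ∫⁻ x, ∑' n : ℕ, ENNReal.ofReal
        ((s₁ - t) ^ n / n.factorial * ((-X x) ^ n * Real.exp (s₁ * X x))) ∂μ := by
      refine lintegral_congr_ae ?_
      filter_upwards [ae_all_iff.2 hnn] with x hx
      have hs : HasSum
          (fun n : ℕ ↦ (s₁ - t) ^ n / n.factorial * ((-X x) ^ n * Real.exp (s₁ * X x)))
          (Real.exp (t * X x)) := by
        have h3 := (NormedSpace.expSeries_div_hasSum_exp ((s₁ - t) * (-X x))).mul_right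
          (Real.exp (s₁ * X x))
        rw [← Real.exp_eq_exp_ℝ, ← Real.exp_add] at h3
        rw [show (s₁ - t) * -X x + s₁ * X x = t * X x by ring] at h3
        refine h3.congr_fun fun n ↦ ?_
        rw [mul_pow]
        ring
      rw [← hs.tsum_eq, ENNReal.ofReal_tsum_of_nonneg hx hs.summable]
    rw [h1, lintegral_tsum hmeas]
    congr 1
    ext n
    rw [hI, ofReal_integral_eq_lintegral_ofReal (hIint n) (hnn n)]
  refine ⟨by fun_prop, ?_⟩
  rw [hasFiniteIntegral_iff_ofReal (ae_of_all _ fun x ↦ (Real.exp_pos _).le), hL,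
    ← ENNReal.ofReal_tsum_of_nonneg (fun n ↦ integral_nonneg_of_ae (hnn n)) hsumI]
  exact ENNReal.ofReal_lt_top

/-- Landau's theorem for the moment generating function of a random variable bounded above. -/
theorem exists_lt_mem_integrableExpSet_of_analyticAt
    (hX : AEMeasurable X μ) {c : ℝ} (hXc : ∀ᵐ x ∂μ, X x ≤ c)
    (hint : Set.Ioi σ₀ ⊆ integrableExpSet X μ) {g : ℂ → ℂ} (hg : AnalyticAt ℂ g σ₀)
    (heq : ∀ᶠ z in 𝓝 (σ₀ : ℂ), σ₀ < z.re → g z = complexMGF X μ z) :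
    ∃ t < σ₀, t ∈ integrableExpSet X μ := by
  have hset : integrableExpSet (fun x ↦ X x - c) μ = integrableExpSet X μ := by
    ext t
    simp only [integrableExpSet, Set.mem_ofPred_eq, mul_sub, Real.exp_sub, div_eq_mul_inv]
    exact integrable_mul_const_iff (inv_ne_zero (Real.exp_pos _).ne').isUnit _
  rw [← hset] at hint ⊢
  -- Shifting X by c multiplies the moment generating function by the entire nonvanishing factor
  -- e^(-zc).
  refine exists_lt_mem_integrableExpSet_of_analyticAt_of_nonpos
    (g := fun z ↦ g z * Complex.exp (-(z * c))) (hX.sub_const c) ?_ hint (by fun_prop) ?_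
  · filter_upwards [hXc] with x hx
    linarith
  · filter_upwards [heq] with z hz hz'
    rw [hz hz', complexMGF, complexMGF, ← integral_mul_const]
    congr 1
    ext x
    rw [← Complex.exp_add]
    push_cast
    ring_nf

/-- A meromorphic function has a limit, possibly infinite, along the whole punctured neighbourhood,
so a limit along any finer nontrivial filter decides its order. Here the product has order > 0;
orders being integers or ⊤, dividing by z - z₀ leaves order ≥ 0. -/
theorem MeromorphicAt.meromorphicOrderAt_nonneg_of_tendsto_sub_mul {F : ℂ → ℂ} {z₀ : ℂ}
    (hF : MeromorphicAt F z₀) {l : Filter ℂ} [l.NeBot] (hl : l ≤ 𝓝[≠] z₀)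
    (hlim : Tendsto (fun z ↦ (z - z₀) * F z) l (𝓝 0)) : 0 ≤ meromorphicOrderAt F z₀ := by
  have hid : MeromorphicAt (fun z : ℂ ↦ z - z₀) z₀ := by fun_prop
  have hG : MeromorphicAt (fun z ↦ (z - z₀) * F z) z₀ := hid.mul hF
  have hpos : 0 < meromorphicOrderAt (fun z ↦ (z - z₀) * F z) z₀ := by
    rcases lt_trichotomy (meromorphicOrderAt (fun z ↦ (z - z₀) * F z) z₀) 0 with h | h | h
    · exact absurd hlim
        (((tendsto_cobounded_of_meromorphicOrderAt_neg h).mono_left hl).not_tendsto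
          (Metric.disjoint_nhds_cobounded 0).symm)
    · obtain ⟨c, hc, hc'⟩ := (tendsto_ne_zero_iff_meromorphicOrderAt_eq_zero hG).2 h
      exact absurd (tendsto_nhds_unique (hc'.mono_left hl) hlim) hc
    · exact h
  have h1 : meromorphicOrderAt (fun z : ℂ ↦ z - z₀) z₀ = 1 :=
    meromorphicOrderAt_id_sub_const
  rw [show (fun z ↦ (z - z₀) * F z) = (fun z ↦ z - z₀) * F from rfl,
    meromorphicOrderAt_mul hid hF, h1] at hpos
  by_contra! hneg
  induction h : meromorphicOrderAt F z₀ with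
  | top => simp [h] at hneg
  | coe n =>
    rw [h] at hpos hneg
    norm_cast at hpos hneg
    omega

/-- Landau's theorem for meromorphic continuations, in the absence of a pole. -/
theorem exists_lt_mem_integrableExpSet_of_meromorphicAt
    (hX : AEMeasurable X μ) {c : ℝ} (hXc : ∀ᵐ x ∂μ, X x ≤ c)
    (hint : Set.Ioi σ₀ ⊆ integrableExpSet X μ) {F : ℂ → ℂ} (hF : MeromorphicAt F σ₀)
    (heq : ∀ᶠ z in 𝓝[≠] (σ₀ : ℂ), σ₀ < z.re → F z = complexMGF X μ z)
    (hlim : Tendsto (fun t ↦ (t - σ₀) * mgf X μ t) (𝓝[>] σ₀) (𝓝 0)) :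
    ∃ t < σ₀, t ∈ integrableExpSet X μ := by
  have hofReal : Tendsto (fun t : ℝ ↦ (t : ℂ)) (𝓝[>] σ₀) (𝓝[≠] (σ₀ : ℂ)) := by
    refine tendsto_nhdsWithin_iff.2 ⟨(Complex.continuous_ofReal.tendsto σ₀).mono_left
      nhdsWithin_le_nhds, ?_⟩
    filter_upwards [self_mem_nhdsWithin] with t ht
    simpa using (ne_of_gt ht)
  have hord : 0 ≤ meromorphicOrderAt F σ₀ := by
    refine hF.meromorphicOrderAt_nonneg_of_tendsto_sub_mul
      (l := (𝓝[>] σ₀).map (fun t : ℝ ↦ (t : ℂ))) hofReal ?_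
    rw [tendsto_map'_iff]
    have h2 : Tendsto (fun t : ℝ ↦ (((t - σ₀) * mgf X μ t : ℝ) : ℂ)) (𝓝[>] σ₀) (𝓝 0) := by
      have := (Complex.continuous_ofReal.tendsto 0).comp hlim
      simpa [Function.comp_def] using this
    refine h2.congr' ?_
    filter_upwards [hofReal.eventually heq, self_mem_nhdsWithin] with t ht ht'
    simp only [Function.comp_apply]
    rw [ht (by simpa using ht'), complexMGF_ofReal]
    push_cast
    ring
  obtain ⟨g, hg, hgF⟩ := (hF.meromorphicOrderAt_nonneg_iff).1 hord
  refine exists_lt_mem_integrableExpSet_of_analyticAt hX hXc hint hg ?_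
  have h3 : ∀ᶠ z in 𝓝[≠] (σ₀ : ℂ), σ₀ < z.re → g z = complexMGF X μ z := by
    filter_upwards [heq, hgF] with z hz hz' hre
    rw [← hz', hz hre]
  rw [eventually_nhdsWithin_iff] at h3
  filter_upwards [h3] with z hz hre
  exact hz (by rintro rfl; simp at hre) hre

end Landau

/-! ### Pointwise lower bounds for |f| -/

namespace LocalZeta

open Filter Topology Set

theorem flatExp_nonneg (p t : ℝ) : 0 ≤ flatExp p t := by
  unfold flatExp
  split_ifs <;> positivity

theorem flatExp_le_one (p t : ℝ) : flatExp p t ≤ 1 := by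
  unfold flatExp
  split_ifs
  · exact zero_le_one
  · rw [Real.exp_le_one_iff]
    exact div_nonpos_of_nonpos_of_nonneg (by norm_num) (by positivity)

theorem flatExp_pos (p : ℝ) {t : ℝ} (ht : t ≠ 0) : 0 < flatExp p t := by
  rw [flatExp, if_neg ht]
  positivity

theorem flatExp_le_flatExp {p : ℝ} (hp : 0 < p) {u t : ℝ} (hu : 0 < u) (hut : u ≤ |t|) :
    flatExp p u ≤ flatExp p t := by
  have ht : t ≠ 0 := by
    rintro rfl
    simp at hut
    linarith
  rw [flatExp, if_neg hu.ne', flatExp, if_neg ht, Real.exp_le_exp, neg_div, neg_div, neg_le_neg_iff,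
    abs_of_pos hu]
  exact one_div_le_one_div_of_le (by positivity) (by gcongr)

theorem measurable_flatExp (p : ℝ) : Measurable (flatExp p) := by
  unfold flatExp
  exact Measurable.ite (measurableSet_singleton 0) measurable_const (by fun_prop)

theorem measurable_modelFun (a b q q' : ℕ) (p p' : ℝ) : Measurable (modelFun a b q q' p p') := by
  have h1 := measurable_flatExp p
  have h2 := measurable_flatExp p'
  unfold modelFun
  fun_prop

variable {a b q q' : ℕ} {p p' : ℝ}

/-- After factoring out x^(a-q') y^(b-q), the remaining factor is a sum of nonnegative terms because
q and q' are even, so no cancellation occurs. -/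
theorem abs_modelFun (hq : Even q) (hqb : q ≤ b) (hq' : Even q') (hq'a : q' ≤ a) (z : ℝ × ℝ) :
    |modelFun a b q q' p p' z| = |z.1| ^ a * |z.2| ^ b + |z.1| ^ a * |z.2| ^ (b - q) * flatExp p z.1
      + |z.1| ^ (a - q') * |z.2| ^ b * flatExp p' z.2 := by
  obtain ⟨x, y⟩ := z
  have hE := flatExp_nonneg p x
  have hE' := flatExp_nonneg p' y
  have key : modelFun a b q q' p p' (x, y) = x ^ (a - q') * y ^ (b - q) *
      (x ^ q' * y ^ q + x ^ q' * flatExp p x + y ^ q * flatExp p' y) := by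
    simp only [modelFun]
    rw [← pow_sub_mul_pow x hq'a, ← pow_sub_mul_pow y hqb]
    ring
  have h1 := hq'.pow_nonneg x
  have h2 := hq.pow_nonneg y
  have h3 : 0 ≤ x ^ q' * y ^ q + x ^ q' * flatExp p x + y ^ q * flatExp p' y := by positivity
  rw [key, abs_mul, abs_mul, abs_pow, abs_pow, abs_of_nonneg h3, ← hq'.pow_abs x,
    ← hq.pow_abs y]
  simp only
  rw [← pow_sub_mul_pow |x| hq'a, ← pow_sub_mul_pow |y| hqb]
  ring

theorem pow_mul_pow_le_abs_modelFun (hq : Even q) (hqb : q ≤ b) (hq' : Even q') (hq'a : q' ≤ a)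
    (z : ℝ × ℝ) : |z.1| ^ a * |z.2| ^ b ≤ |modelFun a b q q' p p' z| := by
  have hE := flatExp_nonneg p z.1
  have hE' := flatExp_nonneg p' z.2
  rw [abs_modelFun hq hqb hq' hq'a, add_assoc]
  exact le_add_of_nonneg_right (by positivity)

theorem pow_mul_pow_mul_flatExp_le_abs_modelFun (hq : Even q) (hqb : q ≤ b) (hq' : Even q')
    (hq'a : q' ≤ a) (z : ℝ × ℝ) :
    |z.1| ^ a * flatExp p z.1 * |z.2| ^ (b - q) ≤ |modelFun a b q q' p p' z| := by
  have hE := flatExp_nonneg p z.1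
  have hE' := flatExp_nonneg p' z.2
  rw [abs_modelFun hq hqb hq' hq'a, mul_right_comm]
  have h1 : 0 ≤ |z.1| ^ a * |z.2| ^ b := by positivity
  have h2 : 0 ≤ |z.1| ^ (a - q') * |z.2| ^ b * flatExp p' z.2 := by positivity
  linarith

theorem ae_fst_ne_zero_and_snd_ne_zero : ∀ᵐ z : ℝ × ℝ, z.1 ≠ 0 ∧ z.2 ≠ 0 := by
  have h : ∀ᵐ x : ℝ, x ≠ 0 := by
    simp [ae_iff]
  exact (Measure.quasiMeasurePreserving_fst.ae h).and (Measure.quasiMeasurePreserving_snd.ae h)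

theorem ae_abs_modelFun_pos (hq : Even q) (hqb : q ≤ b) (hq' : Even q') (hq'a : q' ≤ a) :
    ∀ᵐ z : ℝ × ℝ, 0 < |modelFun a b q q' p p' z| := by
  filter_upwards [ae_fst_ne_zero_and_snd_ne_zero] with z hz
  refine lt_of_lt_of_le ?_ (pow_mul_pow_le_abs_modelFun hq hqb hq' hq'a z)
  have h1 := abs_pos.2 hz.1
  have h2 := abs_pos.2 hz.2
  positivity

/-! ### Integrable majorants -/

/-- The even function `|x| ^ β`, truncated to the interval `[-M, M]`. -/
noncomputable def cutPow (M β x : ℝ) : ℝ := if |x| ≤ M then |x| ^ β else 0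

theorem cutPow_nonneg (M β x : ℝ) : 0 ≤ cutPow M β x := by
  unfold cutPow
  split_ifs <;> positivity

theorem cutPow_of_abs_le {M β x : ℝ} (hx : |x| ≤ M) : cutPow M β x = |x| ^ β := if_pos hx

theorem integral_cutPow {M β : ℝ} (hM : 0 < M) (hβ : -1 < β) :
    ∫ x, cutPow M β x = 2 * (M ^ (β + 1) / (β + 1)) := by
  have h := integral_comp_abs (f := fun u ↦ if u ≤ M then u ^ β else 0)
  unfold cutPow
  rw [h]
  congr 1
  have h2 : ∀ u : ℝ, (if u ≤ M then u ^ β else 0) = (Iic M).indicator (fun u ↦ u ^ β) u := by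
    intro u
    simp [indicator]
  simp_rw [h2]
  rw [setIntegral_indicator measurableSet_Iic, Ioi_inter_Iic,
    ← intervalIntegral.integral_of_le hM.le, integral_rpow (Or.inl hβ),
    Real.zero_rpow (by linarith), sub_zero]

/-- A nonintegrable function has Bochner integral 0 by convention, whereas the computed value is
positive. -/
theorem integrable_cutPow {M β : ℝ} (hM : 0 < M) (hβ : -1 < β) : Integrable (cutPow M β) := by
  by_contra h
  have h1 := integral_cutPow hM hβ
  rw [integral_undef h] at h1
  have : 0 < β + 1 := by linarith
  have : 0 < 2 * (M ^ (β + 1) / (β + 1)) := by positivity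
  linarith

theorem integrable_cutPow_mul_cutPow {M M' β β' : ℝ} (hM : 0 < M) (hβ : -1 < β) (hM' : 0 < M')
    (hβ' : -1 < β') : Integrable (fun z : ℝ × ℝ ↦ cutPow M β z.1 * cutPow M' β' z.2) :=
  (integrable_cutPow hM hβ).mul_prod (integrable_cutPow hM' hβ')

theorem integral_cutPow_mul_cutPow {M M' β β' : ℝ} (hM : 0 < M) (hβ : -1 < β) (hM' : 0 < M')
    (hβ' : -1 < β') : ∫ z : ℝ × ℝ, cutPow M β z.1 * cutPow M' β' z.2
      = 2 * (M ^ (β + 1) / (β + 1)) * (2 * (M' ^ (β' + 1) / (β' + 1))) := by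
  rw [Measure.volume_eq_prod, integral_prod_mul, integral_cutPow hM hβ, integral_cutPow hM' hβ']

theorem rpow_abs_modelFun_le (hq : Even q) (hqb : q ≤ b) (hq' : Even q') (hq'a : q' ≤ a)
    {t : ℝ} (ht : t ≤ 0) {z : ℝ × ℝ} (hx : z.1 ≠ 0) (hy : z.2 ≠ 0) :
    |modelFun a b q q' p p' z| ^ t ≤ |z.1| ^ (a * t) * |z.2| ^ (b * t) := by
  have h1 := abs_pos.2 hx
  have h2 := abs_pos.2 hy
  refine (Real.rpow_le_rpow_of_nonpos (by positivity)
    (pow_mul_pow_le_abs_modelFun hq hqb hq' hq'a z) ht).trans_eq ?_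
  rw [Real.mul_rpow (by positivity) (by positivity), Real.rpow_mul h1.le, Real.rpow_mul h2.le,
    Real.rpow_natCast, Real.rpow_natCast]

theorem rpow_abs_modelFun_le_of_le (hq : Even q) (hqb : q ≤ b) (hq' : Even q') (hq'a : q' ≤ a)
    (hp : 0 < p) {t : ℝ} (ht : t ≤ 0) {η : ℝ} (hη : 0 < η) {z : ℝ × ℝ} (hx : η ≤ |z.1|)
    (hy : z.2 ≠ 0) :
    |modelFun a b q q' p p' z| ^ t
      ≤ (η ^ a * flatExp p η) ^ t * |z.2| ^ (((b - q : ℕ) : ℝ) * t) := by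
  have h2 := abs_pos.2 hy
  have hE := flatExp_pos p hη.ne'
  have hle : η ^ a * flatExp p η * |z.2| ^ (b - q) ≤ |modelFun a b q q' p p' z| := by
    refine le_trans ?_ (pow_mul_pow_mul_flatExp_le_abs_modelFun hq hqb hq' hq'a z)
    have := flatExp_le_flatExp hp hη hx
    gcongr
  refine (Real.rpow_le_rpow_of_nonpos (by positivity) hle ht).trans_eq ?_
  rw [Real.mul_rpow (by positivity) (by positivity), Real.rpow_mul h2.le, Real.rpow_natCast]

theorem exists_bound_of_hasCompactSupport {g : ℝ × ℝ → ℝ} (hg : Continuous g)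
    (hgc : HasCompactSupport g) :
    ∃ K M : ℝ, 0 < K ∧ 0 < M ∧ (∀ z, |g z| ≤ K) ∧ ∀ z, g z ≠ 0 → |z.1| ≤ M ∧ |z.2| ≤ M := by
  obtain ⟨K, hK⟩ := hg.bounded_above_of_compact_support hgc
  obtain ⟨M, hM⟩ := hgc.isCompact.isBounded.exists_norm_le
  refine ⟨max K 1, max M 1, by positivity, by positivity, fun z ↦ (hK z).trans (le_max_left _ _),
    fun z hz ↦ ?_⟩
  have h := (hM z (subset_tsupport g hz)).trans (le_max_left M 1)
  exact ⟨(norm_fst_le z).trans h, (norm_snd_le z).trans h⟩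

section Bounds

variable {g : ℝ × ℝ → ℝ} {K M t : ℝ}

theorem abs_rpow_abs_modelFun_mul_le (hq : Even q) (hqb : q ≤ b) (hq' : Even q') (hq'a : q' ≤ a)
    (ht : t ≤ 0) (hK : ∀ z, |g z| ≤ K)
    (hM : ∀ z, g z ≠ 0 → |z.1| ≤ M ∧ |z.2| ≤ M) {z : ℝ × ℝ} (hx : z.1 ≠ 0) (hy : z.2 ≠ 0) :
    |(|modelFun a b q q' p p' z| ^ t * g z)|
      ≤ K * (cutPow M (a * t) z.1 * cutPow M (b * t) z.2) := by
  have hK0 : 0 ≤ K := (abs_nonneg _).trans (hK z)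
  have h1 := cutPow_nonneg M (a * t) z.1
  have h2 := cutPow_nonneg M (b * t) z.2
  by_cases hz : g z = 0
  · rw [hz, mul_zero, abs_zero]
    positivity
  · rw [abs_mul, abs_of_nonneg (by positivity), mul_comm, cutPow_of_abs_le (hM z hz).1,
      cutPow_of_abs_le (hM z hz).2]
    exact mul_le_mul (hK z) (rpow_abs_modelFun_le hq hqb hq' hq'a ht hx hy) (by positivity) hK0

/-- Splitting at |x| = η: the monomial bound serves the inner strip, and the flat term, bounded
below there, serves the outer part with the smaller y-exponent b - q. -/
theorem abs_rpow_abs_modelFun_mul_le_add (hq : Even q) (hqb : q ≤ b) (hq' : Even q')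
    (hq'a : q' ≤ a) (hp : 0 < p) (ht : t ≤ 0) (hK : ∀ z, |g z| ≤ K)
    (hM : ∀ z, g z ≠ 0 → |z.1| ≤ M ∧ |z.2| ≤ M) {η : ℝ} (hη : 0 < η)
    {z : ℝ × ℝ} (hx : z.1 ≠ 0) (hy : z.2 ≠ 0) :
    |(|modelFun a b q q' p p' z| ^ t * g z)|
      ≤ K * (cutPow η (a * t) z.1 * cutPow M (b * t) z.2) +
        K * (η ^ a * flatExp p η) ^ t *
          (cutPow M 0 z.1 * cutPow M (((b - q : ℕ) : ℝ) * t) z.2) := by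
  have hK0 : 0 ≤ K := (abs_nonneg _).trans (hK z)
  have hE := flatExp_pos p hη.ne'
  have h1 := cutPow_nonneg η (a * t) z.1
  have h2 := cutPow_nonneg M (b * t) z.2
  have h3 := cutPow_nonneg M 0 z.1
  have h4 := cutPow_nonneg M (((b - q : ℕ) : ℝ) * t) z.2
  by_cases hz : g z = 0
  · rw [hz, mul_zero, abs_zero]
    positivity
  rw [abs_mul, abs_of_nonneg (by positivity), mul_comm]
  rcases le_total |z.1| η with h | h
  · refine le_add_of_le_of_nonneg ?_ (by positivity)
    rw [cutPow_of_abs_le h, cutPow_of_abs_le (hM z hz).2]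
    exact mul_le_mul (hK z) (rpow_abs_modelFun_le hq hqb hq' hq'a ht hx hy) (by positivity) hK0
  · refine le_add_of_nonneg_of_le (by positivity) ?_
    rw [cutPow_of_abs_le (hM z hz).1, cutPow_of_abs_le (hM z hz).2, Real.rpow_zero, one_mul,
      mul_assoc]
    exact mul_le_mul (hK z) (rpow_abs_modelFun_le_of_le hq hqb hq' hq'a hp ht hη h hy)
      (by positivity) hK0

theorem integrable_rpow_abs_modelFun_mul (hq : Even q) (hqb : q ≤ b) (hq' : Even q')
    (hq'a : q' ≤ a) (hb : 0 < b) (hab : a ≤ b) (hg : Continuous g) (hgc : HasCompactSupport g)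
    (ht : t ≤ 0) (htb : -1 / (b : ℝ) < t) :
    Integrable (fun z ↦ |modelFun a b q q' p p' z| ^ t * g z) := by
  obtain ⟨K, M, -, hM0, hK, hM⟩ := exists_bound_of_hasCompactSupport hg hgc
  have hb' : (0 : ℝ) < b := by exact_mod_cast hb
  have hab' : (a : ℝ) ≤ b := by exact_mod_cast hab
  have hbt : -1 < b * t := by
    rw [div_lt_iff₀ hb'] at htb
    linarith
  have hat : -1 < a * t := by nlinarith
  have hf := measurable_modelFun a b q q' p p'
  have hgm := hg.measurable
  refine ((integrable_cutPow_mul_cutPow hM0 hat hM0 hbt).const_mul K).mono'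
    (by fun_prop : Measurable _).aestronglyMeasurable ?_
  filter_upwards [ae_fst_ne_zero_and_snd_ne_zero] with z hz
  exact abs_rpow_abs_modelFun_mul_le hq hqb hq' hq'a ht hK hM hz.1 hz.2

end Bounds

/-! ### Absence of a pole at -1/b -/

theorem tendsto_sub_mul_integral_rpow_abs_modelFun (hq : Even q) (hq0 : 0 < q) (hqb : q ≤ b)
    (hq' : Even q') (hq'a : q' ≤ a) (hab : a < b) (hp : 0 < p) {g : ℝ × ℝ → ℝ}
    (hg : Continuous g) (hgc : HasCompactSupport g) (hg0 : ∀ z, 0 ≤ g z) :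
    Tendsto (fun t ↦ (t - (-1 / (b : ℝ))) * ∫ z, |modelFun a b q q' p p' z| ^ t * g z)
      (𝓝[>] (-1 / (b : ℝ))) (𝓝 0) := by
  obtain ⟨K, M, hK0, hM0, hK, hM⟩ := exists_bound_of_hasCompactSupport hg hgc
  have hb : (0 : ℝ) < b := by exact_mod_cast (by omega : 0 < b)
  have hab' : (a : ℝ) < b := by exact_mod_cast hab
  have hc : ((b - q : ℕ) : ℝ) ≤ b - 1 := by
    rw [Nat.cast_sub hqb]
    have : (1 : ℝ) ≤ q := by exact_mod_cast hq0
    linarith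
  set c : ℝ := ((b - q : ℕ) : ℝ) with hcdef
  have hc0 : 0 ≤ c := by positivity
  set σ : ℝ := -1 / (b : ℝ) with hσ
  have hbσ : b * σ = -1 := by rw [hσ]; field_simp
  have hσ0 : σ < 0 := by nlinarith
  have haσ : 0 < a * σ + 1 := by nlinarith
  have hcσ : 0 < c * σ + 1 := by nlinarith
  -- the limit of the upper bound, for a given splitting point
  let L : ℝ → ℝ := fun η ↦ K * (2 * (η ^ (a * σ + 1) / (a * σ + 1))) * (2 / b)
  have hL : Tendsto L (𝓝[>] 0) (𝓝 0) := by
    have h1 : Tendsto (fun η : ℝ ↦ η ^ (a * σ + 1)) (𝓝[>] 0) (𝓝 0) := by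
      have := (Real.continuousAt_rpow_const 0 (a * σ + 1) (Or.inr haσ.le)).tendsto
      rw [Real.zero_rpow haσ.ne'] at this
      exact this.mono_left nhdsWithin_le_nhds
    have h2 := (((h1.div_const (a * σ + 1)).const_mul 2).const_mul K).mul_const (2 / (b : ℝ))
    simpa using h2
  rw [tendsto_order]
  constructor
  · intro u hu
    filter_upwards [self_mem_nhdsWithin] with t ht
    refine hu.trans_le (mul_nonneg (sub_nonneg.2 (le_of_lt ht)) (integral_nonneg fun z ↦ ?_))
    have := hg0 z
    positivity
  intro u hu
  -- η is fixed before t → σ, because the constant of the outer part degenerates as η → 0.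
  obtain ⟨η, hηu, hη⟩ := ((hL.eventually_lt_const hu).and self_mem_nhdsWithin).exists
  have hη0 : (0 : ℝ) < η := hη
  have hE := flatExp_pos p hη0.ne'
  -- This is t - σ times the integrated majorant, with the singular denominator bt + 1 = b(t - σ)
  -- already cancelled, so it is continuous at σ.
  let B : ℝ → ℝ := fun t ↦
    K * (2 * (η ^ (a * t + 1) / (a * t + 1))) * (2 * M ^ (b * t + 1) / b) +
      (t - σ) * (K * (η ^ a * flatExp p η) ^ t *
        ((2 * (M ^ ((0 : ℝ) + 1) / (0 + 1))) * (2 * (M ^ (c * t + 1) / (c * t + 1)))))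
  have hB : Tendsto B (𝓝 σ) (𝓝 (L η)) := by
    have hcont : ContinuousAt B σ := by
      have h1 : ContinuousAt (fun t : ℝ ↦ η ^ (a * t + 1)) σ :=
        ContinuousAt.rpow continuousAt_const (by fun_prop) (Or.inl hη0.ne')
      have h2 : ContinuousAt (fun t : ℝ ↦ M ^ (b * t + 1)) σ :=
        ContinuousAt.rpow continuousAt_const (by fun_prop) (Or.inl hM0.ne')
      have h3 : ContinuousAt (fun t : ℝ ↦ M ^ (c * t + 1)) σ :=
        ContinuousAt.rpow continuousAt_const (by fun_prop) (Or.inl hM0.ne')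
      have h4 : ContinuousAt (fun t : ℝ ↦ (η ^ a * flatExp p η) ^ t) σ :=
        ContinuousAt.rpow continuousAt_const (by fun_prop) (Or.inl (by positivity))
      have h5 : ContinuousAt (fun t : ℝ ↦ η ^ (a * t + 1) / (a * t + 1)) σ :=
        h1.div (by fun_prop) haσ.ne'
      have h6 : ContinuousAt (fun t : ℝ ↦ M ^ (c * t + 1) / (c * t + 1)) σ :=
        h3.div (by fun_prop) hcσ.ne'
      fun_prop
    have : B σ = L η := by
      simp only [B, L, sub_self, zero_mul, add_zero, hbσ]
      norm_num
    rw [← this]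
    exact hcont
  have hneg : ∀ᶠ t in 𝓝[>] σ, t < 0 :=
    nhdsWithin_le_nhds (Iio_mem_nhds hσ0)
  filter_upwards [nhdsWithin_le_nhds (hB.eventually_lt_const hηu), hneg, self_mem_nhdsWithin]
    with t htB ht htσ
  have htσ' : σ < t := htσ
  refine lt_of_le_of_lt ?_ htB
  have hbt : 0 < b * t + 1 := by nlinarith
  have hat : 0 < a * t + 1 := by nlinarith
  have hct : 0 < c * t + 1 := by nlinarith
  have hi1 := (integrable_cutPow_mul_cutPow hη0 (by linarith : -1 < a * t) hM0
    (by linarith : -1 < b * t)).const_mul K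
  have hi2 := (integrable_cutPow_mul_cutPow hM0 (by norm_num : (-1 : ℝ) < 0) hM0
    (by linarith : -1 < c * t)).const_mul (K * (η ^ a * flatExp p η) ^ t)
  have hle : ∫ z, |modelFun a b q q' p p' z| ^ t * g z ≤
      K * ((2 * (η ^ (a * t + 1) / (a * t + 1))) * (2 * (M ^ (b * t + 1) / (b * t + 1)))) +
      K * (η ^ a * flatExp p η) ^ t *
        ((2 * (M ^ ((0 : ℝ) + 1) / (0 + 1))) * (2 * (M ^ (c * t + 1) / (c * t + 1)))) := by
    rw [← integral_cutPow_mul_cutPow hη0 (by linarith : -1 < a * t) hM0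
      (by linarith : -1 < b * t), ← integral_cutPow_mul_cutPow hM0 (by norm_num : (-1 : ℝ) < 0) hM0
      (by linarith : -1 < c * t), ← integral_const_mul, ← integral_const_mul,
      ← integral_add hi1 hi2]
    refine integral_mono_ae (integrable_rpow_abs_modelFun_mul hq hqb hq' hq'a
      (by omega) hab.le hg hgc ht.le htσ) (hi1.add hi2) ?_
    filter_upwards [ae_fst_ne_zero_and_snd_ne_zero] with z hz
    exact (le_abs_self _).trans
      (abs_rpow_abs_modelFun_mul_le_add hq hqb hq' hq'a hp ht.le hK hM hη0 hz.1 hz.2)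
  refine (mul_le_mul_of_nonneg_left hle (sub_nonneg.2 htσ'.le)).trans_eq ?_
  have hbt' : b * t + 1 = b * (t - σ) := by linarith
  have hts : t - σ ≠ 0 := sub_ne_zero.2 htσ'.ne'
  simp only [B]
  rw [mul_add]
  congr 1
  generalize M ^ (b * t + 1) = m
  rw [hbt']
  field_simp

end LocalZeta

/-! ### Divergence to the left of -1/b -/

namespace LocalZeta

open Filter Topology Set ProbabilityTheory

variable {a b q q' : ℕ} {p p' : ℝ}

/-- One term of the exponential series, with n so large that pn > 1, already dominates a multiple of
1/x. -/
theorem not_integrableOn_exp_const_mul_rpow_neg {k r : ℝ} (hk : 0 < k) (hp : 0 < p) (hr : 0 < r)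
    (hr1 : r ≤ 1) : ¬ IntegrableOn (fun x ↦ Real.exp (k * x ^ (-p))) (Ioo 0 r) := by
  intro h
  obtain ⟨n, hn⟩ := exists_nat_gt (1 / p)
  have hpn : 1 < p * n := by
    rwa [div_lt_iff₀ hp, mul_comm] at hn
  have h1 : IntegrableOn (fun x : ℝ ↦ x ^ (-1 : ℝ)) (Ioo 0 r) := by
    refine (h.const_mul (k ^ n / n.factorial)⁻¹).mono'
      (by fun_prop : Measurable _).aestronglyMeasurable ?_
    filter_upwards [ae_restrict_mem measurableSet_Ioo] with x hx
    have hx0 : 0 < x := hx.1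
    rw [Real.norm_of_nonneg (by positivity), le_inv_mul_iff₀ (by positivity)]
    refine le_trans ?_ (Real.pow_div_factorial_le_exp _ (by positivity) n)
    have h2 : x ^ (-1 : ℝ) ≤ (x ^ (-p)) ^ n := by
      rw [← Real.rpow_natCast, ← Real.rpow_mul hx0.le]
      exact Real.rpow_le_rpow_of_exponent_ge hx0 (hx.2.le.trans hr1) (by linarith)
    calc k ^ n / n.factorial * x ^ (-1 : ℝ) ≤ k ^ n / n.factorial * (x ^ (-p)) ^ n := by gcongr
      _ = (k * x ^ (-p)) ^ n / n.factorial := by rw [mul_pow]; ring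
  rw [intervalIntegral.integrableOn_Ioo_rpow_iff hr] at h1
  exact lt_irrefl _ h1

/-- The scale |y| ≤ e with e^q equal to the flat factor is where the first two terms balance:
e^(b-q) e^q = e^b. -/
theorem abs_modelFun_le (hq : Even q) (hqb : q ≤ b) (hq' : Even q') (hq'a : q' ≤ a)
    {e : ℝ} {z : ℝ × ℝ} (hx1 : |z.1| ≤ 1) (hE : flatExp p z.1 = e ^ q)
    (hy : |z.2| ≤ e) : |modelFun a b q q' p p' z| ≤ 3 * e ^ b := by
  have he0 : 0 ≤ e := (abs_nonneg _).trans hy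
  rw [abs_modelFun hq hqb hq' hq'a, hE]
  have h1 : |z.1| ^ a * |z.2| ^ b ≤ 1 * e ^ b := by
    gcongr
    exact pow_le_one₀ (abs_nonneg _) hx1
  have h2 : |z.1| ^ a * |z.2| ^ (b - q) * e ^ q ≤ 1 * e ^ (b - q) * e ^ q := by
    gcongr
    exact pow_le_one₀ (abs_nonneg _) hx1
  have h3 : |z.1| ^ (a - q') * |z.2| ^ b * flatExp p' z.2 ≤ 1 * e ^ b * 1 := by
    have := flatExp_nonneg p' z.2
    gcongr
    · exact pow_le_one₀ (abs_nonneg _) hx1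
    · exact flatExp_le_one _ _
  rw [one_mul, pow_sub_mul_pow e hqb] at h2
  linarith

theorem not_integrable_rpow_abs_modelFun_mul (hq : Even q) (hq0 : 0 < q) (hqb : q ≤ b)
    (hq' : Even q') (hq'a : q' ≤ a) (hp : 0 < p) {g : ℝ × ℝ → ℝ} (hg : Continuous g)
    (hg0 : ∀ z, 0 ≤ g z) (hg00 : 0 < g (0, 0)) {t : ℝ} (ht : t < -1 / (b : ℝ)) :
    ¬ Integrable (fun z ↦ |modelFun a b q q' p p' z| ^ t * g z) := by
  intro hint
  have hb : (0 : ℝ) < b := by exact_mod_cast (by omega : 0 < b)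
  have hqR : (0 : ℝ) < q := by exact_mod_cast hq0
  have hbt : b * t + 1 < 0 := by
    rw [lt_div_iff₀ hb] at ht
    linarith
  have ht0 : t < 0 := by nlinarith
  obtain ⟨δ, hδ, hgδ⟩ : ∃ δ > 0, ∀ z : ℝ × ℝ, dist z (0, 0) < δ → g (0, 0) / 2 < g z :=
    Metric.eventually_nhds_iff.1
      (hg.continuousAt.eventually_const_lt (by linarith : g (0, 0) / 2 < g (0, 0)))
  set r : ℝ := min δ 1 with hr
  have hr0 : 0 < r := by positivity
  have hr1 : r ≤ 1 := min_le_right _ _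
  let e : ℝ → ℝ := fun x ↦ Real.exp (-(1 / q) * x ^ (-p))
  have he_pos : ∀ x, 0 < e x := fun x ↦ Real.exp_pos _
  have he_le : ∀ x, 0 < x → e x ≤ 1 := fun x hx ↦ by
    rw [Real.exp_le_one_iff]
    have : 0 < 1 / (q : ℝ) * x ^ (-p) := by positivity
    linarith
  have heE : ∀ x, 0 < x → flatExp p x = e x ^ q := fun x hx ↦ by
    rw [flatExp, if_neg hx.ne', abs_of_pos hx, ← Real.exp_nat_mul, Real.rpow_neg hx.le]
    congr 1
    field_simp
  have hem : Measurable e := by fun_prop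
  -- As r ≤ 1 and e ≤ 1, the factor r gives both y < e(x) and y < r, which keeps S inside the δ-ball
  -- where g > g(0,0)/2.
  let S : Set (ℝ × ℝ) := {z | (0 < z.1 ∧ z.1 < r) ∧ 0 < z.2 ∧ z.2 < r * e z.1}
  have hS : MeasurableSet S := by
    refine MeasurableSet.inter (MeasurableSet.inter ?_ ?_) (MeasurableSet.inter ?_ ?_)
    · exact measurableSet_lt measurable_const measurable_fst
    · exact measurableSet_lt measurable_fst measurable_const
    · exact measurableSet_lt measurable_const measurable_snd
    · exact measurableSet_lt measurable_snd ((hem.comp measurable_fst).const_mul r)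
  let c : ℝ := g (0, 0) / 2 * 3 ^ t
  have hc : 0 < c := by positivity
  let h : ℝ × ℝ → ℝ := S.indicator fun z ↦ c * e z.1 ^ (b * t)
  have hh : Integrable h := by
    refine hint.mono' ((Measurable.indicator (by fun_prop) hS).aestronglyMeasurable) ?_
    filter_upwards [ae_abs_modelFun_pos (p := p) (p' := p') hq hqb hq' hq'a] with z hz
    by_cases hzS : z ∈ S
    · have hex := he_pos z.1
      obtain ⟨⟨hx0, hxr⟩, hy0, hyr⟩ := hzS
      have hye : z.2 < e z.1 := hyr.trans_le (mul_le_of_le_one_left hex.le hr1)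
      have hyr' : z.2 < r := hyr.trans_le (mul_le_of_le_one_right hr0.le (he_le _ hx0))
      simp only [h]
      rw [indicator_of_mem (show z ∈ S from ⟨⟨hx0, hxr⟩, hy0, hyr⟩),
        Real.norm_of_nonneg (by positivity)]
      have hgz : g (0, 0) / 2 < g z := by
        refine hgδ z ?_
        rw [Prod.dist_eq, max_lt_iff, Real.dist_0_eq_abs, Real.dist_0_eq_abs, abs_of_pos hx0,
          abs_of_pos hy0]
        exact ⟨hxr.trans_le (min_le_left _ _), hyr'.trans_le (min_le_left _ _)⟩
      have hfz := abs_modelFun_le (p := p) (p' := p') hq hqb hq' hq'a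
        (by rw [abs_of_pos hx0]; linarith) (heE _ hx0) (by rw [abs_of_pos hy0]; exact hye.le)
      have hft := Real.rpow_le_rpow_of_nonpos hz hfz ht0.le
      rw [Real.mul_rpow (by norm_num) (by positivity), ← Real.rpow_natCast,
        ← Real.rpow_mul hex.le] at hft
      calc c * e z.1 ^ (b * t) = (3 ^ t * e z.1 ^ (b * t)) * (g (0, 0) / 2) := by ring
        _ ≤ |modelFun a b q q' p p' z| ^ t * g z := by gcongr
    · simp only [h]
      rw [indicator_of_notMem hzS, norm_zero]
      have := hg0 z
      positivity
  rw [Measure.volume_eq_prod] at hh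
  -- A slice has length r·e(x), so the exponent becomes bt + 1, which is negative: the slice
  -- integrals blow up like exp(k x^(-p)) with k > 0.
  have hslice : ∀ x ∈ Ioo 0 r, ∫ y, h (x, y)
      = r * c * Real.exp (-(b * t + 1) / q * x ^ (-p)) := by
    intro x hx
    have h1 : ∀ y, h (x, y) = (Ioo 0 (r * e x)).indicator (fun _ ↦ c * e x ^ (b * t)) y := by
      intro y
      simp only [h, S, indicator, mem_ofPred_eq, mem_Ioo, hx.1, hx.2, true_and, and_self]
    have hre : 0 ≤ r * e x := mul_nonneg hr0.le (he_pos x).le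
    simp_rw [h1]
    rw [integral_indicator measurableSet_Ioo, setIntegral_const, measureReal_def, Real.volume_Ioo,
      sub_zero, ENNReal.toReal_ofReal hre, smul_eq_mul]
    have h2 : e x * e x ^ (b * t) = Real.exp (-(b * t + 1) / q * x ^ (-p)) := by
      simp only [e]
      rw [← Real.exp_mul, ← Real.exp_add]
      congr 1
      ring
    rw [← h2]
    ring
  have h2 : IntegrableOn (fun x ↦ ∫ y, h (x, y)) (Ioo 0 r) :=
    hh.integral_prod_left.integrableOn
  rw [integrableOn_congr_fun hslice measurableSet_Ioo] at h2
  refine not_integrableOn_exp_const_mul_rpow_neg (k := -(b * t + 1) / q) (div_pos (by linarith) hqR)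
    hp hr0 hr1 ?_
  have hrc : r * c ≠ 0 := by positivity
  simpa only [IntegrableOn, integrable_const_mul_iff hrc.isUnit] using h2

/-! ### The zeta integral as a moment generating function -/

section Density

variable {f g : ℝ × ℝ → ℝ}

/-- The measure with density `g` with respect to Lebesgue measure on the plane. -/
noncomputable def densityMeasure (g : ℝ × ℝ → ℝ) : Measure (ℝ × ℝ) :=
  volume.withDensity fun z ↦ ENNReal.ofReal (g z)

theorem integral_densityMeasure {E : Type*} [NormedAddCommGroup E] [NormedSpace ℝ E]
    (hg : Measurable g) (hg0 : ∀ z, 0 ≤ g z) (F : ℝ × ℝ → E) :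
    ∫ z, F z ∂(densityMeasure g) = ∫ z, g z • F z := by
  rw [densityMeasure, integral_withDensity_eq_integral_toReal_smul (by fun_prop)
    (ae_of_all _ fun z ↦ ENNReal.ofReal_lt_top)]
  simp_rw [ENNReal.toReal_ofReal (hg0 _)]

theorem integrable_densityMeasure_iff (hg : Measurable g) (hg0 : ∀ z, 0 ≤ g z)
    (F : ℝ × ℝ → ℝ) : Integrable F (densityMeasure g) ↔ Integrable fun z ↦ F z * g z := by
  rw [densityMeasure, integrable_withDensity_iff (by fun_prop)
    (ae_of_all _ fun z ↦ ENNReal.ofReal_lt_top)]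
  simp_rw [ENNReal.toReal_ofReal (hg0 _)]

theorem exp_mul_log_abs_ae_eq (hf : ∀ᵐ z, 0 < |f z|) (t : ℝ) :
    (fun z ↦ Real.exp (t * Real.log |f z|) * g z) =ᵐ[volume] fun z ↦ |f z| ^ t * g z := by
  filter_upwards [hf] with z hz
  rw [Real.rpow_def_of_pos hz, mul_comm t]

theorem mem_integrableExpSet_log_abs_iff (hf : ∀ᵐ z, 0 < |f z|) (hg : Measurable g)
    (hg0 : ∀ z, 0 ≤ g z) (t : ℝ) :
    t ∈ integrableExpSet (fun z ↦ Real.log |f z|) (densityMeasure g) ↔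
      Integrable fun z ↦ |f z| ^ t * g z := by
  rw [← integrable_congr (exp_mul_log_abs_ae_eq hf t), ← integrable_densityMeasure_iff hg hg0]
  rfl

theorem mgf_log_abs (hf : ∀ᵐ z, 0 < |f z|) (hg : Measurable g)
    (hg0 : ∀ z, 0 ≤ g z) (t : ℝ) :
    mgf (fun z ↦ Real.log |f z|) (densityMeasure g) t = ∫ z, |f z| ^ t * g z := by
  rw [← integral_congr_ae (exp_mul_log_abs_ae_eq hf t), mgf, integral_densityMeasure hg hg0]
  simp_rw [smul_eq_mul, mul_comm]

theorem complexMGF_log_abs (hf : ∀ᵐ z, 0 < |f z|) (hg : Measurable g)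
    (hg0 : ∀ z, 0 ≤ g z) :
    complexMGF (fun z ↦ Real.log |f z|) (densityMeasure g) = zeta f g := by
  ext s
  rw [zeta, complexMGF, integral_densityMeasure hg hg0]
  refine integral_congr_ae ?_
  filter_upwards [hf] with z hz
  rw [Complex.cpow_def_of_ne_zero (by exact_mod_cast hz.ne'), Complex.real_smul, mul_comm,
    Complex.ofReal_log hz.le, mul_comm s]

end Density

/-! ### Continuation up to Re s = -1/b and obstruction at -1/b -/

theorem isOpen_halfPlane (c : ℝ) : IsOpen (halfPlane c) :=
  isOpen_lt continuous_const Complex.continuous_re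

theorem isConnected_halfPlane (c : ℝ) : IsConnected (halfPlane c) :=
  ⟨⟨((c + 1 : ℝ) : ℂ), by simp [halfPlane]⟩, (convex_halfSpace_re_gt c).isPreconnected⟩

theorem continuous_flatExp {p : ℝ} (hp : 0 < p) : Continuous (flatExp p) := by
  have h : flatExp p = fun t ↦ expNegInvGlue (|t| ^ p) := by
    ext t
    by_cases ht : t = 0
    · simp [flatExp, ht, expNegInvGlue, Real.zero_rpow hp.ne']
    · have : 0 < |t| ^ p := by
        have := abs_pos.2 ht
        positivity
      rw [flatExp, if_neg ht, expNegInvGlue, if_neg this.not_ge, neg_div, one_div]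
  rw [h]
  exact (expNegInvGlue.contDiff (n := 0)).continuous.comp
    (continuous_abs.rpow_const fun _ ↦ Or.inr hp.le)

theorem continuous_modelFun (hp : 0 < p) (hp' : 0 < p') : Continuous (modelFun a b q q' p p') := by
  have h1 := continuous_flatExp hp
  have h2 := continuous_flatExp hp'
  unfold modelFun
  fun_prop

section Continuation

variable {g : ℝ × ℝ → ℝ}

theorem Ioi_subset_integrableExpSet (hq : Even q) (hqb : q ≤ b) (hq' : Even q') (hq'a : q' ≤ a)
    (hb : 0 < b) (hab : a ≤ b) (hp : 0 < p) (hp' : 0 < p') (hg : Continuous g)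
    (hgc : HasCompactSupport g) (hg0 : ∀ z, 0 ≤ g z) :
    Ioi (-1 / (b : ℝ)) ⊆
      integrableExpSet (fun z ↦ Real.log |modelFun a b q q' p p' z|) (densityMeasure g) := by
  intro t ht
  rw [mem_integrableExpSet_log_abs_iff (ae_abs_modelFun_pos hq hqb hq' hq'a) hg.measurable hg0]
  rcases le_total t 0 with h | h
  · exact integrable_rpow_abs_modelFun_mul hq hqb hq' hq'a hb hab hg hgc h ht
  · refine Continuous.integrable_of_hasCompactSupport ?_ hgc.mul_left
    exact ((continuous_modelFun hp hp').abs.rpow_const fun z ↦ Or.inr h).mul hg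

theorem analyticOnNhd_zeta (hq : Even q) (hqb : q ≤ b) (hq' : Even q') (hq'a : q' ≤ a)
    (hb : 0 < b) (hab : a ≤ b) (hp : 0 < p) (hp' : 0 < p') (hg : Continuous g)
    (hgc : HasCompactSupport g) (hg0 : ∀ z, 0 ≤ g z) :
    AnalyticOnNhd ℂ (zeta (modelFun a b q q' p p') g) (halfPlane (-1 / (b : ℝ))) := by
  intro s hs
  rw [← complexMGF_log_abs (ae_abs_modelFun_pos hq hqb hq' hq'a) hg.measurable hg0]
  exact analyticAt_complexMGF (interior_maximal
    (Ioi_subset_integrableExpSet hq hqb hq' hq'a hb hab hp hp' hg hgc hg0) isOpen_Ioi hs)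

theorem not_meromorphicallyContinuable (hq : Even q) (hq0 : 0 < q) (hqb : q ≤ b) (hq' : Even q')
    (hq'a : q' ≤ a) (hab : a < b) (hp : 0 < p) (hp' : 0 < p') (hg : Continuous g)
    (hgc : HasCompactSupport g) (hg0 : ∀ z, 0 ≤ g z) (hg00 : 0 < g (0, 0)) {N : Set ℂ}
    (hN : (-1 / (b : ℂ)) ∈ N) :
    ¬ MeromorphicallyContinuable (modelFun a b q q' p p') g (halfPlane (-1 / (b : ℝ)) ∪ N) := by
  rintro ⟨F, hF, hFeq⟩
  have hb : 0 < b := by omega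
  set f := modelFun a b q q' p p' with hf
  set σ : ℝ := -1 / (b : ℝ) with hσ
  have hσN : (σ : ℂ) ∈ N := by
    rw [hσ]
    push_cast
    exact hN
  have hσ0 : σ < 0 := div_neg_of_neg_of_pos (by norm_num) (by exact_mod_cast hb)
  have hfpos : ∀ᵐ z, 0 < |f z| := ae_abs_modelFun_pos hq hqb hq' hq'a
  have hfc : Continuous f := continuous_modelFun hp hp'
  have hZ : AnalyticOnNhd ℂ (zeta f g) (halfPlane σ) :=
    analyticOnNhd_zeta hq hqb hq' hq'a hb hab.le hp hp' hg hgc hg0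
  have hFσ : MeromorphicAt F σ := hF σ (Or.inr hσN)
  have hdiff : MeromorphicOn (F - zeta f g) (halfPlane σ) := fun z hz ↦
    (hF z (Or.inl hz)).sub (hZ z hz).meromorphicAt
  have h1 : (1 : ℂ) ∈ halfPlane σ := by
    simp only [halfPlane, mem_ofPred_eq, Complex.one_re]
    linarith
  -- The continuation is only prescribed on Re s > 0; the identity theorem on the connected
  -- half-plane carries the agreement to Re s > σ.
  have htop1 : meromorphicOrderAt (F - zeta f g) 1 = ⊤ := by
    rw [meromorphicOrderAt_eq_top_iff]
    have : halfPlane 0 ∈ 𝓝 (1 : ℂ) := (isOpen_halfPlane 0).mem_nhds (by simp [halfPlane])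
    filter_upwards [nhdsWithin_le_nhds this] with z hz
    rw [Pi.sub_apply, hFeq z hz, sub_self]
  have htop : ∀ z ∈ halfPlane σ, meromorphicOrderAt (F - zeta f g) z = ⊤ := by
    intro z hz
    by_contra hne
    exact hdiff.meromorphicOrderAt_ne_top_of_isPreconnected
      (isConnected_halfPlane σ).isPreconnected hz h1 hne htop1
  -- Infinite order gives equality only on punctured neighbourhoods. Near σ, F is analytic off σ
  -- itself, which upgrades this to equality at the point.
  have heq : ∀ᶠ z in 𝓝[≠] (σ : ℂ), σ < z.re → F z = zeta f g z := by
    filter_upwards [hFσ.eventually_analyticAt] with z hz hre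
    have hd : AnalyticAt ℂ (F - zeta f g) z := hz.sub (hZ z hre)
    have h2 := (meromorphicOrderAt_eq_top_iff.1 (htop z hre)).frequently
    have h3 := (hd.frequently_zero_iff_eventually_zero.1 h2).self_of_nhds
    exact sub_eq_zero.1 h3
  obtain ⟨C, hC⟩ := (hgc.isCompact.image hfc.abs).bddAbove
  -- log|f| need not be bounded above on the plane, but the measure only sees the points where g is
  -- positive.
  have hbound : ∀ᵐ z ∂(densityMeasure g), Real.log |f z| ≤ C := by
    rw [densityMeasure, ae_withDensity_iff (hg.measurable.ennreal_ofReal)]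
    refine ae_of_all _ fun z hz ↦ ?_
    have hgz : g z ≠ 0 := by
      intro h
      exact hz (by simp only [h, ENNReal.ofReal_zero])
    exact (Real.log_le_self (abs_nonneg _)).trans
      (hC (mem_image_of_mem _ (subset_tsupport g hgz)))
  have hlim := tendsto_sub_mul_integral_rpow_abs_modelFun (p' := p') hq hq0 hqb hq' hq'a hab hp
    hg hgc hg0
  replace hlim := hlim.congr fun t ↦ by rw [← mgf_log_abs hfpos hg.measurable hg0]
  rw [← complexMGF_log_abs hfpos hg.measurable hg0] at heq
  obtain ⟨t, ht, htmem⟩ := exists_lt_mem_integrableExpSet_of_meromorphicAt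
    (X := fun z ↦ Real.log |f z|) (Real.measurable_log.comp hfc.abs.measurable).aemeasurable hbound
    (Ioi_subset_integrableExpSet hq hqb hq' hq'a hb hab.le hp hp' hg hgc hg0) hFσ heq hlim
  rw [mem_integrableExpSet_log_abs_iff hfpos hg.measurable hg0] at htmem
  exact not_integrable_rpow_abs_modelFun_mul hq hq0 hqb hq' hq'a hp hg hg0 hg00 ht htmem

/-- The moment generating function argument needs a nonnegative density, so g is split into positive
and negative parts. These may lose smoothness, which is why the estimates assume only continuity. -/
theorem meromorphicallyContinuable_halfPlane (hq : Even q) (hqb : q ≤ b) (hq' : Even q')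
    (hq'a : q' ≤ a) (hb : 0 < b) (hab : a ≤ b) (hp : 0 < p) (hp' : 0 < p') (hg : Continuous g)
    (hgc : HasCompactSupport g) :
    MeromorphicallyContinuable (modelFun a b q q' p p') g (halfPlane (-1 / (b : ℝ))) := by
  have key : ∀ g : ℝ × ℝ → ℝ, Continuous g → HasCompactSupport g → ∀ s ∈ halfPlane 0,
      Integrable fun z ↦ ((|modelFun a b q q' p p' z| : ℝ) : ℂ) ^ s * ((g z : ℝ) : ℂ) := by
    intro g hg hgc s hs
    refine Continuous.integrable_of_hasCompactSupport ?_
      (hgc.comp_left (g := ((↑) : ℝ → ℂ)) Complex.ofReal_zero).mul_left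
    exact ((Complex.continuous_ofReal_cpow_const hs).comp (continuous_modelFun hp hp').abs).mul
      (Complex.continuous_ofReal.comp hg)
  have hc1 : Continuous fun z ↦ max (g z) 0 := by fun_prop
  have hc2 : Continuous fun z ↦ max (-g z) 0 := by fun_prop
  have hs1 : HasCompactSupport fun z ↦ max (g z) 0 :=
    hgc.comp_left (g := fun x : ℝ ↦ max x 0) (by simp)
  have hs2 : HasCompactSupport fun z ↦ max (-g z) 0 :=
    hgc.comp_left (g := fun x : ℝ ↦ max (-x) 0) (by simp)
  have ha1 := analyticOnNhd_zeta (p := p) (p' := p') hq hqb hq' hq'a hb hab hp hp' hc1 hs1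
    fun z ↦ le_max_right _ _
  have ha2 := analyticOnNhd_zeta (p := p) (p' := p') hq hqb hq' hq'a hb hab hp hp' hc2 hs2
    fun z ↦ le_max_right _ _
  refine ⟨_, (ha1.sub ha2).meromorphicOn, fun s hs ↦ ?_⟩
  rw [Pi.sub_apply, zeta, zeta, zeta, ← integral_sub (key _ hc1 hs1 s hs) (key _ hc2 hs2 s hs)]
  congr 1
  ext z
  rw [← mul_sub, ← Complex.ofReal_sub, max_zero_sub_max_neg_zero_eq_self]

end Continuation

theorem MeromorphicallyContinuable.mono {f φ : ℝ × ℝ → ℝ} {V W : Set ℂ}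
    (h : MeromorphicallyContinuable f φ W) (hVW : V ⊆ W) : MeromorphicallyContinuable f φ V :=
  let ⟨F, hF, hFeq⟩ := h
  ⟨F, fun z hz ↦ hF z (hVW hz), hFeq⟩

theorem exists_isTestFunction {U : Set (ℝ × ℝ)} (hU : IsOpen U) {z₀ : ℝ × ℝ} (hz₀ : z₀ ∈ U) :
    ∃ φ, IsTestFunction U φ ∧ (∀ z, 0 ≤ φ z) ∧ 0 < φ z₀ := by
  obtain ⟨φ, hsupp, hc, hsmooth, hrange, h1⟩ :=
    exists_contDiff_tsupport_subset (n := ⊤) (hU.mem_nhds hz₀)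
  refine ⟨φ, ⟨hsmooth, hc, hsupp⟩, fun z ↦ (hrange (mem_range_self z)).1, ?_⟩
  rw [h1]
  exact one_pos

end LocalZeta

theorem corollary3p4 (a b q q' : ℕ) (p p' : ℝ)
    (ha : 2 ≤ a) (hab : a < b)
    (hp : 0 < p) (hp' : 0 < p')
    (hq_even : Even q) (hq : 2 ≤ q) (hqb : q ≤ b)
    (hq'_even : Even q') (hq' : 2 ≤ q') (hq'a : q' ≤ a)
    (U : Set (ℝ × ℝ)) (hU : IsOpen U) (hU0 : (0, 0) ∈ U) :
    (∀ φ : ℝ × ℝ → ℝ, LocalZeta.IsTestFunction U φ →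
      0 < φ (0, 0) → (∀ z ∈ U, 0 ≤ φ z) →
      ∀ N : Set ℂ, IsOpen N → (-1 / (b : ℂ)) ∈ N →
        ¬ LocalZeta.MeromorphicallyContinuable (LocalZeta.modelFun a b q q' p p') φ
            (LocalZeta.halfPlane (-1 / (b : ℝ)) ∪ N)) ∧
    LocalZeta.mZero U (LocalZeta.modelFun a b q q' p p') = ENNReal.ofReal (1 / (b : ℝ)) := by
  have hb : 0 < b := by omega
  have hbR : (0 : ℝ) < b := by exact_mod_cast hb
  have hq0 : 0 < q := by omega
  refine ⟨fun φ hφ hφ0 hφU N _ hN ↦ ?_, le_antisymm ?_ ?_⟩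
  · refine LocalZeta.not_meromorphicallyContinuable hq_even hq0 hqb hq'_even hq'a hab hp hp'
      hφ.smooth.continuous hφ.compact_support (fun z ↦ ?_) hφ0 hN
    by_cases hz : z ∈ tsupport φ
    · exact hφU z (hφ.support_subset hz)
    · exact (image_eq_zero_of_notMem_tsupport hz).ge
  · obtain ⟨φ, hφ, hφnn, hφ0⟩ := LocalZeta.exists_isTestFunction hU hU0
    refine (iInf₂_le φ hφ).trans (iSup_le fun ρ ↦ iSup_le fun hρ ↦ iSup_le fun hcont ↦ ?_)
    refine ENNReal.ofReal_le_ofReal ?_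
    by_contra! hlt
    have hneg : -ρ < -1 / (b : ℝ) := by
      rw [neg_div]
      linarith
    -- If ρ > 1/b, the half-plane Re s > -ρ is itself an admissible neighbourhood of -1/b.
    refine LocalZeta.not_meromorphicallyContinuable hq_even hq0 hqb hq'_even hq'a hab hp hp'
      hφ.smooth.continuous hφ.compact_support hφnn hφ0 (N := LocalZeta.halfPlane (-ρ)) ?_
      (hcont.mono (Set.union_subset (fun z hz ↦ lt_trans hneg hz) subset_rfl))
    have : (-1 / (b : ℂ)) = ((-1 / (b : ℝ) : ℝ) : ℂ) := by push_cast; rfl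
    rw [this]
    simpa only [LocalZeta.halfPlane, Set.mem_ofPred_eq, Complex.ofReal_re] using hneg
  · refine le_iInf₂ fun φ hφ ↦ ?_
    refine le_iSup_of_le (1 / (b : ℝ)) (le_iSup_of_le (by positivity) (le_iSup_of_le ?_ le_rfl))
    rw [← neg_div]
    exact LocalZeta.meromorphicallyContinuable_halfPlane hq_even hqb hq'_even hq'a hb hab.le hp hp'
      hφ.smooth.continuous hφ.compact_support
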